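/- Let $m\ge 2$ and $n\ge 1$, and let $A=(a_{i_1 i_2\cdots i_m})_{i_1,\dots,i_m\in[n]}$ be a tensor with entries in $\mathbb R\cup\{\infty\}$. For $i\in[n]$ let $$S_i:=\bigl\{\{i_2,\dots,i_m\} : i_2,\dots,i_m\in[n],\ a_{i i_2\cdots i_m}\neq\infty\bigr\},$$ where $\{i_2,\dots,i_m\}$ is the set of the indices $i_2,\dots,i_m$, and assume that the $S_i$ are nonempty and mutually equal (for instance, because the corresponding collections of multisets are nonempty and mutually equal). A number $\lambda\in\mathbb R$ is a tropical H-eigenvalue of $A$ if there is $x\in\mathbb R^n$ with $$\min_{i_2,\dots,i_m\in[n]}\bigl(a_{i i_2\cdots i_m}+x_{i_2}+\dots+x_{i_m}\bigr)=\lambda+(m-1)x_i\qquad\text{for all } i\in[n].$$ Then $A$ has exactly one tropical H-eigenvalue $\lambda(A)\in\mathbb R$, and the following hold, where all maxima and minima are attained. 1. $\lambda(A)$ is the maximum of $\lambda$ over all $(x,\lambda)\in\mathbb R^n\times\mathbb R$ with $$a_{i_1 i_2\cdots i_m}+x_{i_2}+\dots+x_{i_m}\ \ge\ \lambda+(m-1)x_{i_1}\qquad\text{for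 all }(i_1,\dots,i_m)\in[n]^m .$$ 2. $\lambda(A)$ is the minimum of $\sum_{(i_1,\dots,i_m)\in[n]^m}a_{i_1\cdots i_m}\,y_{i_1\cdots i_m}$ (with $\infty\cdot 0=0$ and $\infty\cdot c=\infty$ for $c>0$) over the H-cycle polytope, that is, over all $y\in\mathbb R^{n^m}$ with $$\sum_{(i_1,\dots,i_m)\in[n]^m} y_{i_1\cdots i_m}\bigl((m-1)e_{i_1}-e_{i_2}-\dots-e_{i_m}\bigr)=0,\qquad \sum_{(i_1,\dots,i_m)\in[n]^m} y_{i_1\cdots i_m}=1,\qquad y_{i_1\cdots i_m}\ge 0,$$ where $e_1,\dots,e_n$ is the standard basis of $\mathbb R^n$. 3. Let $\mathcal H(A)$ be the weighted directed hypergraph with vertex set $[n]$ whose hyperedges are the pairs $(i,M)$ with $i\in[n]$ and $M$ a multiset of $m-1$ elements of $[n]$, the weight $w(i,M)$ being the least entry $a_{i i_2\cdots i_m}$ with $\{i_2,\dots,i_m\}=M$ as multisets (all these entries are equal if $A$ is symmetric in its last $m-1$ indices). An H-cycle is a finite sequence, of length $r\ge1$, of hyperedges $(i_1^{(j)},\{i_2^{(j)},\dots,i_m^{(j)}\})$,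 $j=1,\dots,r$, possibly repeated, with $$\sum_{j=1}^r\bigl((m-1)e_{i_1^{(j)}}-e_{i_2^{(j)}}-\dots-e_{i_m^{(j)}}\bigr)=0;$$ its normalized weight is the sum of the weights of its $r$ hyperedges divided by $r$. Then $\lambda(A)$ is the minimum of the normalized weights of all H-cycles of $\mathcal H(A)$. -/

import Mathlib

noncomputable section

namespace TropicalTensor

/-- A tensor of order `m` and rank `n` with entries in `ℝ ∪ {∞}`. The entry `a_{i₁ i₂ ⋯ i_m}` is
`A i₁ J`, where the tuple `J` lists the last `m - 1` indices `i₂, …, i_m`. -/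
abbrev Tensor (m n : ℕ) : Type := Fin n → (Fin (m - 1) → Fin n) → WithTop ℝ

/-- The collection `S_i = {{i₂, …, i_m} : a_{i i₂ ⋯ i_m} ≠ ∞}`. -/
def finiteSupport {m n : ℕ} (A : Tensor m n) (i : Fin n) : Set (Set (Fin n)) :=
  {T | ∃ J : Fin (m - 1) → Fin n, A i J ≠ ⊤ ∧ T = Set.range J}

/-- `(x, lam)` is a tropical (min-plus) H-eigenpair of `A`. The condition is unchanged when a
constant is added to all coordinates of `x`, so `x` may be read as a representative of a class in
`ℝⁿ / ℝ(1, …, 1)`. -/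
def IsHEigenpair {m n : ℕ} (A : Tensor m n) (x : Fin n → ℝ) (lam : ℝ) : Prop :=
  ∀ i : Fin n,
    (Finset.univ.inf fun J : Fin (m - 1) → Fin n => A i J + ((∑ k, x (J k) : ℝ) : WithTop ℝ)) =
      ((lam + ((m : ℝ) - 1) * x i : ℝ) : WithTop ℝ)

/-- `lam` is a tropical H-eigenvalue of `A`. -/
def IsHEigenvalue {m n : ℕ} (A : Tensor m n) (lam : ℝ) : Prop :=
  ∃ x : Fin n → ℝ, IsHEigenpair A x lam

/-- Feasibility of `(x, lam)` in the primal linear program: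
`a_{i₁ ⋯ i_m} + x_{i₂} + ⋯ + x_{i_m} ≥ lam + (m - 1) x_{i₁}` for all indices. -/
def IsLPFeasible {m n : ℕ} (A : Tensor m n) (x : Fin n → ℝ) (lam : ℝ) : Prop :=
  ∀ (i : Fin n) (J : Fin (m - 1) → Fin n),
    ((lam + ((m : ℝ) - 1) * x i : ℝ) : WithTop ℝ) ≤ A i J + ((∑ k, x (J k) : ℝ) : WithTop ℝ)

/-- The H-cycle polytope `H_{n,m}`. -/
def hCyclePolytope (m n : ℕ) : Set (Fin n → (Fin (m - 1) → Fin n) → ℝ) :=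
  {y | (∑ i, ∑ J, y i J •
          (((m : ℝ) - 1) • (Pi.single i 1 : Fin n → ℝ) - ∑ k, (Pi.single (J k) 1 : Fin n → ℝ)) = 0) ∧
       (∑ i, ∑ J, y i J = 1) ∧
       ∀ i J, 0 ≤ y i J}

/-- The dual objective `∑ a_{i₁ ⋯ i_m} y_{i₁ ⋯ i_m}`, for `y ≥ 0`. Multiplication in `WithTop ℝ`
has `∞ * 0 = 0`, and `∞ * c = ∞` for `c > 0`. -/
def dualObjective {m n : ℕ} (A : Tensor m n) (y : Fin n → (Fin (m - 1) → Fin n) → ℝ) : WithTop ℝ :=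
  ∑ i, ∑ J, A i J * (y i J : WithTop ℝ)

/-- A weighted F-hypergraph on `V`: a hyperedge is a pair of multisets whose tail has exactly one
element, i.e. a pair (tail vertex, head multiset). -/
structure WeightedFHypergraph (V : Type*) where
  edges : Set (V × Multiset V)
  weight : V × Multiset V → WithTop ℝ

/-- The multiset `{i₂, …, i_m}` of the entries of a tuple. -/
def tupleMultiset {d n : ℕ} (J : Fin d → Fin n) : Multiset (Fin n) :=
  Finset.univ.val.map J

/-- The weighted F-hypergraph of a tensor. The weight of `(i, M)` is the least entry `a_{i i₂ ⋯ i_m}`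
with `{i₂, …, i_m} = M`; when `A` is symmetric in its last `m - 1` indices, all these entries are
equal. -/
def hypergraph {m n : ℕ} (A : Tensor m n) : WeightedFHypergraph (Fin n) where
  edges := {e | ∃ J : Fin (m - 1) → Fin n, e.2 = tupleMultiset J}
  weight e :=
    (Finset.univ.filter fun J : Fin (m - 1) → Fin n => tupleMultiset J = e.2).inf fun J => A e.1 J

/-- An H-cycle in an F-hypergraph all of whose heads have `m - 1` elements: a nonempty finite
sequence of hyperedges (repetitions allowed) with
`∑_j ((m - 1) e_{i₁^{(j)}} - e_{i₂^{(j)}} - ⋯ - e_{i_m^{(j)}}) = 0`. -/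
def IsHCycle {V : Type*} [DecidableEq V] (H : WeightedFHypergraph V)
    (c : List (V × Multiset V)) : Prop :=
  c ≠ [] ∧ (∀ e ∈ c, e ∈ H.edges) ∧
    (c.map fun e => (Multiset.card e.2 : ℤ) • (Pi.single e.1 1 : V → ℤ) -
      (e.2.map fun v => (Pi.single v 1 : V → ℤ)).sum).sum = 0

/-- The normalized weight of a sequence of hyperedges: total weight divided by the length. -/
def normalizedWeight {V : Type*} (H : WeightedFHypergraph V) (c : List (V × Multiset V)) :
    WithTop ℝ :=
  WithTop.map (fun w : ℝ => w / (c.length : ℝ)) (c.map H.weight).sum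

end TropicalTensor

end

/-! Everything follows from one eigenpair `(x, lam)`. Write `d = m - 1` and let `T` be the min-plus
operator of `A`. Existence is a vanishing discount argument: for `α < 1` the map `x ↦ T(α x) / d` is
a sup-norm contraction, so it has a fixed point. Equality of the supports bounds the oscillation of
these fixed points uniformly in `α` (`discounted_oscillation_le`), so after normalization they
subconverge as `α → 1`, and the limit is an eigenvector. An eigenpair is LP feasible, and
feasibility bounds `lam` above by every dual objective and every normalized cycle weight, because
potentials cancel along balanced combinations. Feasible values are at most any eigenvalue by a
maximum principle, which also gives uniqueness. For attainment, choose a tight tuple `J i` for each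
`i`. The choice has a nonzero balanced vector of natural numbers (`exists_nat_stationary`); scaled
to total mass one it is an optimal point of the polytope, and read as multiplicities it is an
optimal H-cycle. -/

namespace TropicalTensor

open Finset Filter Topology

/-! ### Eigenvectors of min-plus operators by vanishing discount. -/

section ShapleyOperator

variable {ι : Type*} {d : ℕ}

/-- The min-plus operator `x ↦ min_J (a i J + ∑ k, x (J k))`, the minimum being over `J ∈ S i`. -/
def minPlusOp (S : ι → Finset (Fin d → ι)) (hS : ∀ i, (S i).Nonempty)
    (a : ι → (Fin d → ι) → ℝ) (x : ι → ℝ) (i : ι) : ℝ :=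
  (S i).inf' (hS i) fun J => a i J + ∑ k, x (J k)

variable {S : ι → Finset (Fin d → ι)} {hS : ∀ i, (S i).Nonempty} {a : ι → (Fin d → ι) → ℝ}

lemma minPlusOp_le (x : ι → ℝ) {i : ι} {J : Fin d → ι} (hJ : J ∈ S i) :
    minPlusOp S hS a x i ≤ a i J + ∑ k, x (J k) :=
  Finset.inf'_le (fun J => a i J + ∑ k, x (J k)) hJ

lemma exists_minPlusOp_eq (x : ι → ℝ) (i : ι) :
    ∃ J ∈ S i, minPlusOp S hS a x i = a i J + ∑ k, x (J k) :=
  Finset.exists_mem_eq_inf' (hS i) _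

/-- Monotonicity and additive homogeneity in one inequality: each of the `d` summands shifts by `t`.
-/
lemma minPlusOp_le_add {x y : ι → ℝ} {t : ℝ} (h : ∀ i, x i ≤ y i + t) (i : ι) :
    minPlusOp S hS a x i ≤ minPlusOp S hS a y i + d * t := by
  obtain ⟨J, hJ, e⟩ := exists_minPlusOp_eq (hS := hS) (a := a) y i
  have h1 := minPlusOp_le (hS := hS) (a := a) x hJ
  have h2 : ∑ k, x (J k) ≤ ∑ k, (y (J k) + t) := Finset.sum_le_sum fun k _ => h _
  rw [Finset.sum_add_distrib] at h2
  simp only [sum_const, card_univ, Fintype.card_fin, nsmul_eq_mul] at h2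
  linarith

lemma minPlusOp_sub_const (x : ι → ℝ) (c : ℝ) (i : ι) :
    minPlusOp S hS a (fun j => x j - c) i = minPlusOp S hS a x i - d * c := by
  apply le_antisymm
  · have := minPlusOp_le_add (S := S) (hS := hS) (a := a) (x := fun j => x j - c) (y := x)
      (t := -c) (fun j => by linarith) i
    linarith
  · have := minPlusOp_le_add (S := S) (hS := hS) (a := a) (x := x) (y := fun j => x j - c)
      (t := c) (fun j => by linarith) i
    linarith

lemma continuous_minPlusOp (i : ι) : Continuous fun x => minPlusOp S hS a x i := by
  unfold minPlusOp
  exact Continuous.finset_inf'_apply (hS i) fun J _ => by fun_prop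

lemma exists_discounted_fixedPoint [Fintype ι] (hd : 0 < d) {α : ℝ} (h0 : 0 ≤ α) (h1 : α < 1) :
    ∃ x : ι → ℝ, ∀ i, minPlusOp S hS a (fun j => α * x j) i = d * x i := by
  have hd' : (0 : ℝ) < d := by exact_mod_cast hd
  let F : (ι → ℝ) → (ι → ℝ) := fun x i => minPlusOp S hS a (fun j => α * x j) i / d
  have key : ∀ (x y : ι → ℝ) (i : ι), F x i - F y i ≤ α * dist x y := by
    intro x y i
    have := minPlusOp_le_add (S := S) (hS := hS) (a := a) (x := fun j => α * x j)
      (y := fun j => α * y j) (t := α * dist x y) (fun j => by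
        have h2 : x j - y j ≤ dist x y :=
          (le_abs_self _).trans (by rw [← Real.dist_eq]; exact dist_le_pi_dist x y j)
        nlinarith [mul_le_mul_of_nonneg_left h2 h0]) i
    simp only [F]
    rw [← sub_div, div_le_iff₀ hd']
    linarith
  have hc : ContractingWith ⟨α, h0⟩ F := by
    refine ⟨by exact_mod_cast h1, LipschitzWith.of_dist_le_mul fun x y => ?_⟩
    change dist (F x) (F y) ≤ α * dist x y
    refine (dist_pi_le_iff (by positivity)).2 fun i => ?_
    rw [Real.dist_eq, abs_le]
    have e := key y x i
    rw [dist_comm] at e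
    exact ⟨by linarith, key x y i⟩
  refine ⟨hc.fixedPoint, fun i => ?_⟩
  have := congrFun hc.fixedPoint_isFixedPt i
  simp only [F] at this
  rw [div_eq_iff hd'.ne'] at this
  linarith

/-- A shared index cancels, so only `d - 1` terms contribute oscillation. This gain of one is what
makes the oscillation bound close up. -/
lemma sum_comp_sub_sum_comp_le (x : ι → ℝ) {D : ℝ} (hD : ∀ u v, x u - x v ≤ D)
    {J J' : Fin d → ι} {k₀ k₁ : Fin d} (h : J' k₀ = J k₁) :
    ∑ k, x (J' k) - ∑ k, x (J k) ≤ (d - 1) * D := by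
  -- Reindexing by the swap pairs the position `k₀` of `J'` with the position `k₁` of `J`, where the
  -- values agree.
  rw [← Equiv.sum_comp (Equiv.swap k₀ k₁) fun k => x (J k), ← Finset.sum_sub_distrib,
    ← Finset.add_sum_erase _ _ (Finset.mem_univ k₀)]
  have h2 : ∑ k ∈ univ.erase k₀, (x (J' k) - x (J (Equiv.swap k₀ k₁ k))) ≤
      ∑ k ∈ univ.erase k₀, D := Finset.sum_le_sum fun k _ => hD _ _
  have h3 : 1 ≤ d := Nat.one_le_of_lt k₀.2
  simp only [sum_const, card_erase_of_mem (mem_univ k₀), card_univ, Fintype.card_fin,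
    nsmul_eq_mul, Nat.cast_sub h3, Nat.cast_one] at h2
  simpa [h] using h2

/-- Let `D` be the oscillation, attained between a minimizer `i` and a maximizer `j`. Comparing an
optimal tuple at `i` with a tuple at `j` sharing an index gives `d * D ≤ 2 * K + (d - 1) * D`, hence
`D ≤ 2 * K` whatever `α` is. -/
lemma discounted_oscillation_le [Fintype ι] (hd : 0 < d)
    (hr : ∀ i j, ∀ J ∈ S i, ∃ J' ∈ S j, ∃ k₀ k₁, J' k₀ = J k₁)
    {K : ℝ} (hK : ∀ i J, |a i J| ≤ K) {α : ℝ} (h0 : 0 ≤ α) (h1 : α ≤ 1) {x : ι → ℝ}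
    (hx : ∀ i, minPlusOp S hS a (fun j => α * x j) i = d * x i) (u v : ι) :
    x u - x v ≤ 2 * K := by
  obtain ⟨i, hi⟩ := @Finite.exists_min ι ℝ _ ⟨u⟩ _ x
  obtain ⟨j, hj⟩ := @Finite.exists_max ι ℝ _ ⟨u⟩ _ x
  have hD : ∀ u v, x u - x v ≤ x j - x i := fun u v => by linarith [hj u, hi v]
  obtain ⟨J, hJ, e⟩ := exists_minPlusOp_eq (hS := hS) (a := a) (fun j => α * x j) i
  obtain ⟨J', hJ', k₀, k₁, hk⟩ := hr i j J hJ
  have e' := minPlusOp_le (hS := hS) (a := a) (fun j => α * x j) hJ'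
  rw [hx, ← Finset.mul_sum] at e e'
  have h2 := sum_comp_sub_sum_comp_le x hD hk
  have h3 := (abs_le.1 (hK i J)).1
  have h4 := (abs_le.1 (hK j J')).2
  have hD0 : 0 ≤ x j - x i := by linarith [hj i]
  have hd' : (1 : ℝ) ≤ d := by exact_mod_cast hd
  have h5 := mul_le_mul_of_nonneg_left h2 h0
  have h6 : α * ((d - 1) * (x j - x i)) ≤ 1 * ((d - 1) * (x j - x i)) :=
    mul_le_mul_of_nonneg_right h1 (mul_nonneg (by linarith) hD0)
  linarith [hD u v]

theorem exists_minPlusOp_eigenvector [Fintype ι] [Nonempty ι] (hd : 0 < d)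
    (hr : ∀ i j, ∀ J ∈ S i, ∃ J' ∈ S j, ∃ k₀ k₁, J' k₀ = J k₁) :
    ∃ (x : ι → ℝ) (lam : ℝ), ∀ i, minPlusOp S hS a x i = lam + d * x i := by
  classical
  obtain ⟨o⟩ := ‹Nonempty ι›
  obtain ⟨p, hp⟩ := @Finite.exists_max (ι × (Fin d → ι)) ℝ _ ⟨(o, fun _ => o)⟩ _
    fun p => |a p.1 p.2|
  set K := |a p.1 p.2| with hKdef
  have hK : ∀ i J, |a i J| ≤ K := fun i J => hp (i, J)
  let α : ℕ → ℝ := fun k => 1 - 1 / ((k : ℝ) + 1)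
  have hα0 : ∀ k, 0 ≤ α k := fun k => by
    have : 1 / ((k : ℝ) + 1) ≤ 1 := by
      rw [div_le_one (by positivity)]
      linarith [(Nat.cast_nonneg k : (0 : ℝ) ≤ k)]
    simp only [α]
    linarith
  have hα1 : ∀ k, α k < 1 := fun k => by
    have : 0 < 1 / ((k : ℝ) + 1) := by positivity
    simp only [α]
    linarith
  have hα : Tendsto α atTop (𝓝 1) := by
    simpa [α] using (tendsto_const_nhds (x := (1 : ℝ))).sub tendsto_one_div_add_atTop_nhds_zero_nat
  choose x hx using fun k =>
    exists_discounted_fixedPoint (S := S) (hS := hS) (a := a) hd (hα0 k) (hα1 k)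
  -- The fixed points themselves may diverge as `α → 1`; their differences from the value at `o`
  -- stay bounded.
  let z : ℕ → ι → ℝ := fun k j => x k j - x k o
  have hz : ∀ k, z k ∈ Set.pi Set.univ fun _ : ι => Set.Icc (-(2 * K)) (2 * K) := by
    intro k j _
    have h1 := discounted_oscillation_le hd hr hK (hα0 k) (hα1 k).le (hx k) j o
    have h2 := discounted_oscillation_le hd hr hK (hα0 k) (hα1 k).le (hx k) o j
    exact ⟨by simp only [z]; linarith, h1⟩
  -- Both sides equal `d * (1 - α k) * x k o`; this common value tends to the eigenvalue along the
  -- subsequence.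
  have hTz : ∀ k i, minPlusOp S hS a (α k • z k) i - d * z k i =
      minPlusOp S hS a (α k • z k) o - d * z k o := by
    intro k i
    have e : α k • z k = fun j => α k * x k j - α k * x k o := by
      ext j
      simp only [z, Pi.smul_apply, smul_eq_mul]
      ring
    rw [e, minPlusOp_sub_const, minPlusOp_sub_const, hx, hx]
    simp only [z]
    ring
  obtain ⟨w, -, φ, hφ, hw⟩ :=
    (isCompact_univ_pi fun _ : ι => isCompact_Icc).tendsto_subseq hz
  have hlim : ∀ i, Tendsto (fun k => minPlusOp S hS a (α (φ k) • z (φ k)) i - d * z (φ k) i)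
      atTop (𝓝 (minPlusOp S hS a w i - d * w i)) := by
    intro i
    have h1 : Tendsto (fun k => α (φ k) • z (φ k)) atTop (𝓝 w) := by
      simpa using (hα.comp hφ.tendsto_atTop).smul hw
    exact (((continuous_minPlusOp i).tendsto w).comp h1).sub
      (((tendsto_pi_nhds.1 hw) i).const_mul _)
  refine ⟨w, minPlusOp S hS a w o - d * w o, fun i => ?_⟩
  have h1 := hlim i
  simp only [hTz] at h1
  linarith [tendsto_nhds_unique h1 (hlim o)]

end ShapleyOperator

/-! ### Balanced integer multiplicities. -/

/-- A map assigning to each index a tuple of `d` indices has a nonzero stationary vector with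
nonnegative integer entries. -/
theorem exists_nat_stationary {n d : ℕ} [Nonempty (Fin n)] (J : Fin n → Fin d → Fin n) :
    ∃ N : Fin n → ℕ, N ≠ 0 ∧
      ∀ j, ∑ i, (N i : ℤ) * ((d : ℤ) * (Pi.single i 1 : Fin n → ℤ) j -
        ∑ k, (Pi.single (J i k) 1 : Fin n → ℤ) j) = 0 := by
  let C : Fin n → Fin n → ℤ := fun i j => ∑ k, (Pi.single (J i k) 1 : Fin n → ℤ) j
  have hC0 : ∀ i j, 0 ≤ C i j := fun i j => Finset.sum_nonneg fun k _ => by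
    rw [Pi.single_apply]; split_ifs <;> simp
  have hCsum : ∀ i, ∑ j, C i j = d := fun i => by
    simp only [C]
    rw [Finset.sum_comm]
    simp
  let M : Matrix (Fin n) (Fin n) ℤ :=
    Matrix.of fun i j => (d : ℤ) * (Pi.single i 1 : Fin n → ℤ) j - C i j
  -- The rows of `M` sum to zero, so it kills the all-ones vector; singularity then yields an
  -- integer left kernel vector.
  have hdet : M.det = 0 := by
    rw [← Matrix.exists_mulVec_eq_zero_iff]
    refine ⟨1, one_ne_zero, ?_⟩
    ext i
    simp [M, Matrix.mulVec, dotProduct, Finset.sum_sub_distrib, ← Finset.mul_sum, hCsum]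
  obtain ⟨v, hv0, hv⟩ := Matrix.exists_vecMul_eq_zero_iff.2 hdet
  have expand : ∀ (w : Fin n → ℤ) (j : Fin n),
      ∑ i, w i * ((d : ℤ) * (Pi.single i 1 : Fin n → ℤ) j - C i j) =
        d * w j - ∑ i, w i * C i j := by
    intro w j
    simp only [mul_sub, Finset.sum_sub_distrib]
    congr 1
    rw [Finset.sum_eq_single j] <;> simp +contextual [mul_comm, eq_comm]
  have hvj : ∀ j, (d : ℤ) * v j = ∑ i, v i * C i j := fun j => by
    have h := congrFun hv j
    rw [Matrix.vecMul, dotProduct] at h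
    have h' := expand v j
    simp only [M, Matrix.of_apply, Pi.zero_apply] at h
    linarith
  -- Signs are removed by the triangle inequality: both sides have the same sum over `j`, so every
  -- inequality is an equality and `|v|` is in the left kernel too.
  have hle : ∀ j ∈ univ, (d : ℤ) * |v j| ≤ ∑ i, |v i| * C i j := fun j _ => by
    have h : |(d : ℤ) * v j| = d * |v j| := by rw [abs_mul, Nat.abs_cast]
    rw [← h, hvj]
    refine (Finset.abs_sum_le_sum_abs _ _).trans (le_of_eq ?_)
    exact Finset.sum_congr rfl fun i _ => by rw [abs_mul, abs_of_nonneg (hC0 i j)]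
  have hsum : ∑ j, (d : ℤ) * |v j| = ∑ j, ∑ i, |v i| * C i j := by
    rw [Finset.sum_comm]
    simp [← Finset.mul_sum, hCsum, mul_comm, ← Finset.sum_mul]
  have heq := (Finset.sum_eq_sum_iff_of_le hle).1 hsum
  refine ⟨fun i => (v i).natAbs, fun h => hv0 ?_, fun j => ?_⟩
  · ext i
    simpa using congrFun h i
  · have h := expand (fun i => |v i|) j
    rw [← heq j (mem_univ j), sub_self] at h
    simpa only [C, Int.natCast_natAbs] using h

/-! ### Existence and uniqueness of the H-eigenvalue. -/

variable {m n : ℕ} {A : Tensor m n}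

lemma isHEigenpair_iff [Nonempty (Fin n)] {x : Fin n → ℝ} {lam : ℝ} :
    IsHEigenpair A x lam ↔ IsLPFeasible A x lam ∧
      ∀ i, ∃ J, A i J + ((∑ k, x (J k) : ℝ) : WithTop ℝ) =
        ((lam + ((m : ℝ) - 1) * x i : ℝ) : WithTop ℝ) := by
  constructor
  · intro h
    refine ⟨fun i J => (h i).symm.trans_le (Finset.inf_le (mem_univ J)), fun i => ?_⟩
    obtain ⟨J, -, e⟩ := Finset.exists_mem_eq_inf univ univ_nonempty
      fun J : Fin (m - 1) → Fin n => A i J + ((∑ k, x (J k) : ℝ) : WithTop ℝ)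
    exact ⟨J, e.symm.trans (h i)⟩
  · rintro ⟨h1, h2⟩ i
    obtain ⟨J, e⟩ := h2 i
    exact le_antisymm ((Finset.inf_le (mem_univ J)).trans e.le) (Finset.le_inf fun J _ => h1 i J)

lemma cast_pred_order (hm : 2 ≤ m) : ((m - 1 : ℕ) : ℝ) = (m : ℝ) - 1 := by
  rw [Nat.cast_sub (by omega), Nat.cast_one]

theorem exists_isHEigenpair [Nonempty (Fin n)] (hm : 2 ≤ m)
    (hne : ∀ i, (finiteSupport A i).Nonempty)
    (heq : ∀ i j, finiteSupport A i = finiteSupport A j) :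
    ∃ x lam, IsHEigenpair A x lam := by
  classical
  let S : Fin n → Finset (Fin (m - 1) → Fin n) := fun i => univ.filter fun J => A i J ≠ ⊤
  have hS : ∀ i, (S i).Nonempty := fun i => by
    obtain ⟨T, J, hJ, -⟩ := hne i
    exact ⟨J, by simpa [S] using hJ⟩
  have hd : 0 < m - 1 := by omega
  -- Infinite entries get the dummy value `0`, which never enters the minimum because `S i` excludes
  -- them.
  obtain ⟨x, lam, hx⟩ := exists_minPlusOp_eigenvector (S := S) (hS := hS)
    (a := fun i J => (A i J).untopD 0) hd (by
      intro i j J hJ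
      -- Equal supports give a `J'` with the same range as `J`, so any one entry of `J'`, here the
      -- first, also occurs in `J`.
      have : Set.range J ∈ finiteSupport A j := heq i j ▸ ⟨J, by simpa [S] using hJ, rfl⟩
      obtain ⟨J', hJ', e⟩ := this
      have h : J' ⟨0, hd⟩ ∈ Set.range J := e ▸ Set.mem_range_self _
      obtain ⟨k₁, hk⟩ := h
      exact ⟨J', by simpa [S] using hJ', _, k₁, hk.symm⟩)
  rw [cast_pred_order hm] at hx
  refine ⟨x, lam, isHEigenpair_iff.2 ⟨fun i J => ?_, fun i => ?_⟩⟩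
  · by_cases hJ : A i J = ⊤
    · simp [hJ]
    · obtain ⟨b, hb⟩ := WithTop.ne_top_iff_exists.1 hJ
      have h := minPlusOp_le (hS := hS) (a := fun i J => (A i J).untopD 0) x
        (show J ∈ S i by simpa [S] using hJ)
      rw [hx] at h
      rw [← hb] at h ⊢
      exact_mod_cast h
  · obtain ⟨J, hJ, e⟩ := exists_minPlusOp_eq (hS := hS) (a := fun i J => (A i J).untopD 0) x i
    obtain ⟨b, hb⟩ := WithTop.ne_top_iff_exists.1 (show A i J ≠ ⊤ by simpa [S] using hJ)
    refine ⟨J, ?_⟩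
    rw [hx, ← hb] at e
    rw [← hb]
    exact_mod_cast e.symm

/-- Maximum principle: at a maximizer `i` of `x - y`, take a tuple tight for `y`. Replacing `y` by
`x` raises the sum over the tuple by at most `(m - 1) * (x i - y i)`, exactly the change on the
other side. -/
theorem IsLPFeasible.le_of_isHEigenpair [Nonempty (Fin n)] (hm : 2 ≤ m) {x y : Fin n → ℝ}
    {t lam : ℝ} (hx : IsLPFeasible A x t) (hy : IsHEigenpair A y lam) : t ≤ lam := by
  obtain ⟨i, hi⟩ := Finite.exists_max fun i => x i - y i
  obtain ⟨J, hJ⟩ := (isHEigenpair_iff.1 hy).2 i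
  have hx' := hx i J
  have htop : A i J ≠ ⊤ := fun h => by
    rw [h, top_add] at hJ
    exact WithTop.top_ne_coe hJ
  obtain ⟨b, hb⟩ := WithTop.ne_top_iff_exists.1 htop
  rw [← hb] at hJ hx'
  rw [← WithTop.coe_add, WithTop.coe_inj] at hJ
  rw [← WithTop.coe_add, WithTop.coe_le_coe] at hx'
  have h : ∑ k, x (J k) ≤ ∑ k, (y (J k) + (x i - y i)) :=
    Finset.sum_le_sum fun k _ => by linarith [hi (J k)]
  rw [Finset.sum_add_distrib] at h
  simp only [sum_const, card_univ, Fintype.card_fin, nsmul_eq_mul, cast_pred_order hm] at h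
  linarith

/-! ### Linear programming duality on the H-cycle polytope. -/

lemma IsLPFeasible.coe_sub_le {x : Fin n → ℝ} {lam : ℝ} (h : IsLPFeasible A x lam)
    (i : Fin n) (J : Fin (m - 1) → Fin n) :
    ((lam + ((m : ℝ) - 1) * x i - ∑ k, x (J k) : ℝ) : WithTop ℝ) ≤ A i J := by
  have := h i J
  cases hA : A i J with
  | top => exact le_top
  | coe b =>
    rw [hA] at this
    norm_cast at this ⊢
    linarith

lemma coe_mul_le_mul_coe {a : WithTop ℝ} {b c : ℝ} (h : (b : WithTop ℝ) ≤ a) (hc : 0 ≤ c) :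
    ((b * c : ℝ) : WithTop ℝ) ≤ a * (c : WithTop ℝ) := by
  cases a with
  | top =>
    rcases hc.eq_or_lt with rfl | hc
    · simp
    · rw [WithTop.top_mul (by exact_mod_cast hc.ne')]
      exact le_top
  | coe a =>
    rw [← WithTop.coe_mul]
    exact_mod_cast mul_le_mul_of_nonneg_right (by exact_mod_cast h) hc

/-- Pairing the balance condition of the H-cycle polytope with a potential `x`. -/
lemma sum_reduced_cost_eq {y : Fin n → (Fin (m - 1) → Fin n) → ℝ} (hy : y ∈ hCyclePolytope m n)
    (x : Fin n → ℝ) (lam : ℝ) :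
    ∑ i, ∑ J, (lam + ((m : ℝ) - 1) * x i - ∑ k, x (J k)) * y i J = lam := by
  obtain ⟨h1, h2, -⟩ := hy
  have h3 := congrArg (fun v : Fin n → ℝ => x ⬝ᵥ v) h1
  simp only [dotProduct_sum, dotProduct_smul, dotProduct_sub, dotProduct_single, mul_one,
    smul_eq_mul, dotProduct_zero] at h3
  calc _ = lam * ∑ i, ∑ J, y i J +
        ∑ i, ∑ J, y i J * (((m : ℝ) - 1) * x i - ∑ k, x (J k)) := by
        simp only [Finset.mul_sum, ← Finset.sum_add_distrib]
        exact Finset.sum_congr rfl fun i _ => Finset.sum_congr rfl fun J _ => by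
          ring
    _ = lam := by rw [h2, h3]; ring

theorem IsLPFeasible.le_dualObjective {x : Fin n → ℝ} {lam : ℝ} (h : IsLPFeasible A x lam)
    {y : Fin n → (Fin (m - 1) → Fin n) → ℝ} (hy : y ∈ hCyclePolytope m n) :
    (lam : WithTop ℝ) ≤ dualObjective A y := by
  rw [← sum_reduced_cost_eq hy x lam, dualObjective]
  simp only [WithTop.coe_sum]
  exact Finset.sum_le_sum fun i _ => Finset.sum_le_sum fun J _ =>
    coe_mul_le_mul_coe (h.coe_sub_le i J) (hy.2.2 i J)

/-- Complementary slackness: `N`, scaled to total mass one, is supported on tight entries, where the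
cost equals the reduced cost that pairs to `lam`. -/
theorem exists_dualObjective_eq {x : Fin n → ℝ} {lam : ℝ} (hm : 2 ≤ m)
    {J : Fin n → Fin (m - 1) → Fin n}
    (hJ : ∀ i, A i (J i) = ((lam + ((m : ℝ) - 1) * x i - ∑ k, x (J i k) : ℝ) : WithTop ℝ))
    {N : Fin n → ℕ} (hN0 : N ≠ 0)
    (hN : ∀ j, ∑ i, (N i : ℤ) * (((m - 1 : ℕ) : ℤ) * (Pi.single i 1 : Fin n → ℤ) j -
        ∑ k, (Pi.single (J i k) 1 : Fin n → ℤ) j) = 0) :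
    ∃ y ∈ hCyclePolytope m n, dualObjective A y = (lam : WithTop ℝ) := by
  classical
  have hs : (∑ i, (N i : ℝ)) ≠ 0 := by
    intro h
    apply hN0
    ext i
    have := (Finset.sum_eq_zero_iff_of_nonneg fun i _ => Nat.cast_nonneg (α := ℝ) (N i)).1 h i
      (mem_univ i)
    exact_mod_cast this
  set s := ∑ i, (N i : ℝ) with hsdef
  let y : Fin n → (Fin (m - 1) → Fin n) → ℝ := fun i => Pi.single (J i) (N i / s)
  have hy : y ∈ hCyclePolytope m n := by
    refine ⟨?_, ?_, fun i K => ?_⟩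
    · have e : ∀ i, ∑ K, y i K • (((m : ℝ) - 1) • (Pi.single i 1 : Fin n → ℝ) -
          ∑ k, (Pi.single (K k) 1 : Fin n → ℝ)) =
          (N i / s) • (((m : ℝ) - 1) • (Pi.single i 1 : Fin n → ℝ) -
          ∑ k, (Pi.single (J i k) 1 : Fin n → ℝ)) := fun i => by
        rw [Finset.sum_eq_single (J i)] <;> simp +contextual [y]
      simp only [e]
      ext j
      have h := congrArg (Int.cast : ℤ → ℝ) (hN j)
      push_cast [cast_pred_order hm] at h
      have hcast : ∀ i : Fin n, (((Pi.single i 1 : Fin n → ℤ) j : ℤ) : ℝ) =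
          (Pi.single i 1 : Fin n → ℝ) j := fun i => by
        simp only [Pi.single_apply]; split_ifs <;> simp
      simp only [hcast] at h
      simp only [Finset.sum_apply, Pi.smul_apply, Pi.sub_apply, smul_eq_mul, Pi.zero_apply,
        div_mul_eq_mul_div]
      rw [← Finset.sum_div, h, zero_div]
    · simp only [y, Finset.sum_pi_single', mem_univ, if_true]
      rw [← Finset.sum_div, ← hsdef, div_self hs]
    · have : 0 ≤ (N i : ℝ) / s := div_nonneg (Nat.cast_nonneg _)
        (Finset.sum_nonneg fun i _ => Nat.cast_nonneg _)
      simp only [y, Pi.single_apply]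
      split_ifs
      · exact this
      · exact le_rfl
  refine ⟨y, hy, ?_⟩
  rw [← sum_reduced_cost_eq hy x lam, dualObjective]
  simp only [WithTop.coe_sum]
  refine Finset.sum_congr rfl fun i _ => Finset.sum_congr rfl fun K _ => ?_
  by_cases hK : K = J i
  · subst hK
    rw [hJ, ← WithTop.coe_mul]
  -- Off the support both terms vanish, using `∞ * 0 = 0` if the entry is infinite.
  · simp [y, Pi.single_eq_of_ne hK]

/-! ### H-cycles in the weighted hypergraph. -/

lemma sum_map_tupleMultiset {d : ℕ} {β : Type*} [AddCommMonoid β] (f : Fin n → β)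
    (J : Fin d → Fin n) : ((tupleMultiset J).map f).sum = ∑ k, f (J k) := by
  rw [tupleMultiset, Multiset.map_map]
  rfl

lemma card_tupleMultiset {d : ℕ} (J : Fin d → Fin n) : Multiset.card (tupleMultiset J) = d := by
  simp [tupleMultiset]

lemma IsLPFeasible.le_weight {x : Fin n → ℝ} {lam : ℝ} (h : IsLPFeasible A x lam)
    (e : Fin n × Multiset (Fin n)) :
    ((lam + ((m : ℝ) - 1) * x e.1 - (e.2.map x).sum : ℝ) : WithTop ℝ) ≤
      (hypergraph A).weight e := by
  refine Finset.le_inf fun J hJ => ?_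
  rw [← (Finset.mem_filter.1 hJ).2, sum_map_tupleMultiset]
  exact h.coe_sub_le e.1 J

/-- The lower bound from feasibility depends only on the multiset, so a tight entry is least among
all orderings of its tuple. -/
lemma IsLPFeasible.weight_eq {x : Fin n → ℝ} {lam : ℝ} (h : IsLPFeasible A x lam)
    {i : Fin n} {J : Fin (m - 1) → Fin n}
    (hJ : A i J = ((lam + ((m : ℝ) - 1) * x i - ∑ k, x (J k) : ℝ) : WithTop ℝ)) :
    (hypergraph A).weight (i, tupleMultiset J) =
      ((lam + ((m : ℝ) - 1) * x i - ((tupleMultiset J).map x).sum : ℝ) : WithTop ℝ) := by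
  refine le_antisymm ?_ (h.le_weight (i, tupleMultiset J))
  rw [sum_map_tupleMultiset, ← hJ]
  exact Finset.inf_le (f := fun J => A i J) (by simp)

/-- The reduced weights of an H-cycle sum to its length times `lam`. -/
lemma IsHCycle.sum_reduced_weight (hm : 2 ≤ m) {c : List (Fin n × Multiset (Fin n))}
    (hc : IsHCycle (hypergraph A) c) (x : Fin n → ℝ) (lam : ℝ) :
    (c.map fun e => lam + ((m : ℝ) - 1) * x e.1 - (e.2.map x).sum).sum = c.length * lam := by
  obtain ⟨-, he, h0⟩ := hc
  -- Pairing with the potential `x` turns the vector balance condition into a scalar identity.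
  let L : (Fin n → ℤ) →+ ℝ :=
    { toFun := fun v => ∑ i, (v i : ℝ) * x i
      map_zero' := by simp
      map_add' := fun u v => by simp [add_mul, Finset.sum_add_distrib] }
  have hL : ∀ i, L (Pi.single i 1) = x i := fun i => by
    change ∑ j, (((Pi.single i 1 : Fin n → ℤ) j : ℤ) : ℝ) * x j = x i
    rw [Finset.sum_eq_single i] <;> simp +contextual
  have h1 := congrArg L h0
  rw [map_list_sum, List.map_map, map_zero] at h1
  have h2 : (c.map fun e => lam + ((m : ℝ) - 1) * x e.1 - (e.2.map x).sum) =
      c.map fun e => lam + L ((Multiset.card e.2 : ℤ) • (Pi.single e.1 1 : Fin n → ℤ) -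
        (e.2.map fun v => (Pi.single v 1 : Fin n → ℤ)).sum) := by
    refine List.map_congr_left fun e hec => ?_
    obtain ⟨J, hJ⟩ := he e hec
    rw [map_sub, map_zsmul, map_multiset_sum, Multiset.map_map, hL, hJ, card_tupleMultiset]
    simp only [Function.comp_def, hL, natCast_zsmul, nsmul_eq_mul, cast_pred_order hm]
    ring
  rw [h2, List.sum_map_add, List.map_const', List.sum_replicate, nsmul_eq_mul]
  have h3 : (c.map fun e => L ((Multiset.card e.2 : ℤ) • (Pi.single e.1 1 : Fin n → ℤ) -
        (e.2.map fun v => (Pi.single v 1 : Fin n → ℤ)).sum)).sum = 0 := h1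
  rw [h3, add_zero]

theorem IsLPFeasible.le_normalizedWeight (hm : 2 ≤ m) {x : Fin n → ℝ} {lam : ℝ}
    (h : IsLPFeasible A x lam) {c : List (Fin n × Multiset (Fin n))}
    (hc : IsHCycle (hypergraph A) c) :
    (lam : WithTop ℝ) ≤ normalizedWeight (hypergraph A) c := by
  have h1 : (((c.map fun e => lam + ((m : ℝ) - 1) * x e.1 - (e.2.map x).sum).sum : ℝ) :
      WithTop ℝ) ≤ (c.map (hypergraph A).weight).sum := by
    rw [← WithTop.coe_addHom, map_list_sum, List.map_map]
    exact List.sum_le_sum fun e _ => h.le_weight e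
  rw [hc.sum_reduced_weight hm] at h1
  have hlen : (0 : ℝ) < c.length := by exact_mod_cast List.length_pos_iff.2 hc.1
  rw [normalizedWeight]
  cases hw : (c.map (hypergraph A).weight).sum with
  | top => exact le_top
  | coe w =>
    rw [hw] at h1
    rw [WithTop.map_coe]
    norm_cast at h1 ⊢
    rw [le_div_iff₀ hlen]
    linarith

theorem exists_normalizedWeight_eq (hm : 2 ≤ m) {x : Fin n → ℝ} {lam : ℝ}
    (h : IsLPFeasible A x lam) {J : Fin n → Fin (m - 1) → Fin n}
    (hJ : ∀ i, A i (J i) = ((lam + ((m : ℝ) - 1) * x i - ∑ k, x (J i k) : ℝ) : WithTop ℝ))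
    {N : Fin n → ℕ} (hN0 : N ≠ 0)
    (hN : ∀ j, ∑ i, (N i : ℤ) * (((m - 1 : ℕ) : ℤ) * (Pi.single i 1 : Fin n → ℤ) j -
        ∑ k, (Pi.single (J i k) 1 : Fin n → ℤ) j) = 0) :
    ∃ c, IsHCycle (hypergraph A) c ∧ normalizedWeight (hypergraph A) c = (lam : WithTop ℝ) := by
  -- Each tight hyperedge is repeated `N i` times, so the balance of `N` is the H-cycle condition.
  let c : List (Fin n × Multiset (Fin n)) :=
    (List.finRange n).flatMap fun i => List.replicate (N i) (i, tupleMultiset (J i))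
  have hmem : ∀ e ∈ c, ∃ i, e = (i, tupleMultiset (J i)) := fun e he => by
    obtain ⟨i, -, hi⟩ := List.mem_flatMap.1 he
    exact ⟨i, List.eq_of_mem_replicate hi⟩
  have hc : IsHCycle (hypergraph A) c := by
    refine ⟨fun h0 => hN0 ?_, fun e he => ?_, ?_⟩
    · ext i
      have := List.flatMap_eq_nil_iff.1 h0 i (List.mem_finRange i)
      simpa using this
    · obtain ⟨i, rfl⟩ := hmem e he
      exact ⟨J i, rfl⟩
    · simp only [c, List.map_flatMap, List.map_replicate, card_tupleMultiset,
        sum_map_tupleMultiset]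
      rw [List.flatMap_def, List.sum_flatten, List.map_map]
      simp only [Function.comp_def, List.sum_replicate]
      rw [← List.ofFn_eq_map, List.sum_ofFn]
      ext j
      simpa [Finset.sum_apply] using hN j
  refine ⟨c, hc, ?_⟩
  have h1 : (c.map (hypergraph A).weight).sum = ((c.length * lam : ℝ) : WithTop ℝ) := by
    rw [← hc.sum_reduced_weight hm x lam, ← WithTop.coe_addHom, map_list_sum, List.map_map]
    congr 1
    refine List.map_congr_left fun e he => ?_
    obtain ⟨i, rfl⟩ := hmem e he
    exact h.weight_eq (hJ i)
  have hlen : (c.length : ℝ) ≠ 0 := by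
    exact_mod_cast (List.length_pos_iff.2 hc.1).ne'
  rw [normalizedWeight, h1, WithTop.map_coe, mul_div_cancel_left₀ _ hlen]

end TropicalTensor

/-! ### Assembly of the main theorem. -/

open TropicalTensor in
theorem mainTheorem3 (m n : ℕ) (hm : 2 ≤ m) (hn : 1 ≤ n) (A : TropicalTensor.Tensor m n)
    (hne : ∀ i : Fin n, (TropicalTensor.finiteSupport A i).Nonempty)
    (heq : ∀ i j : Fin n,
      TropicalTensor.finiteSupport A i = TropicalTensor.finiteSupport A j) :
    ∃ lam : ℝ,
      (TropicalTensor.IsHEigenvalue A lam ∧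
        ∀ mu : ℝ, TropicalTensor.IsHEigenvalue A mu → mu = lam) ∧
      IsGreatest {t : ℝ | ∃ x : Fin n → ℝ, TropicalTensor.IsLPFeasible A x t} lam ∧
      IsLeast (TropicalTensor.dualObjective A '' TropicalTensor.hCyclePolytope m n)
        (lam : WithTop ℝ) ∧
      IsLeast (TropicalTensor.normalizedWeight (TropicalTensor.hypergraph A) ''
          {c | TropicalTensor.IsHCycle (TropicalTensor.hypergraph A) c})
        (lam : WithTop ℝ) := by
  have : Nonempty (Fin n) := ⟨⟨0, hn⟩⟩
  obtain ⟨x, lam, hx⟩ := exists_isHEigenpair hm hne heq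
  obtain ⟨hfeas, htight⟩ := isHEigenpair_iff.1 hx
  choose J hJ using htight
  have hJ' : ∀ i, A i (J i) =
      ((lam + ((m : ℝ) - 1) * x i - ∑ k, x (J i k) : ℝ) : WithTop ℝ) := fun i => by
    have := hJ i
    cases hA : A i (J i) with
    | top =>
      rw [hA, top_add] at this
      exact (WithTop.top_ne_coe this).elim
    | coe b =>
      rw [hA] at this
      norm_cast at this ⊢
      linarith
  obtain ⟨N, hN0, hN⟩ := exists_nat_stationary J
  refine ⟨lam, ⟨⟨x, hx⟩, ?_⟩, ⟨⟨x, hfeas⟩, ?_⟩, ⟨?_, ?_⟩, ⟨?_, ?_⟩⟩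
  · rintro mu ⟨y, hy⟩
    exact le_antisymm ((isHEigenpair_iff.1 hy).1.le_of_isHEigenpair hm hx)
      (hfeas.le_of_isHEigenpair hm hy)
  · rintro t ⟨y, hy⟩
    exact hy.le_of_isHEigenpair hm hx
  · exact exists_dualObjective_eq hm hJ' hN0 hN
  · rintro _ ⟨y, hy, rfl⟩
    exact hfeas.le_dualObjective hy
  · exact exists_normalizedWeight_eq hm hfeas hJ' hN0 hN
  · rintro _ ⟨c, hc, rfl⟩
    exact hfeas.le_normalizedWeight hm hc
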